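/- \textbf{Theorem.} Let $\mathcal M$ be a finite von Neumann algebra with separable predual, with center $\mathscr Z(\mathcal M)=\mathcal M\cap\mathcal M'$, and let $\mathcal A$ be a von Neumann algebra with $\mathscr Z(\mathcal M)\subseteq\mathcal A\subseteq\mathcal M$ such that $\mathcal A$ is abelian and regular in $\mathcal M$, i.e. $\{u\in\mathscr U(\mathcal M): u\mathcal A u^*=\mathcal A\}''=\mathcal M$. Suppose that $\mathcal A\prec^s_{\mathcal M}\mathscr Z(\mathcal M)$, i.e. for every nonzero projection $p'\in\mathcal A'\cap\mathcal M$ one has $\mathcal A p'\prec_{\mathcal M}\mathscr Z(\mathcal M)$. Then there is a sequence $(r_n)_{n\in\mathbb N}$ of pairwise orthogonal (possibly zero) projections in $\mathcal A$ such that $\sum_n r_n=1$ strongly and $\mathcal A=\bigoplus_n\mathscr Z(\mathcal M)r_n$ as an internal ($\ell^\infty$-)direct sum of von Neumann algebras: for every norm-bounded sequence $y_n\in\mathscr Z(\mathcal M)r_n$ the series $\sum_n y_n$ converges strongly to an element of $\mathcal A$, and every element of $\mathcal A$ is of this form for a unique such sequence. Here, for a von Neumann subalgebra $\mathcal N_2\subseteq\mathcal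 M$ and a not necessarily unital von Neumann subalgebra $\mathcal N_1\subseteq\mathcal M$, $\mathcal N_1\prec_{\mathcal M}\mathcal N_2$ means that there exist nonzero projections $p\in\mathcal N_1$, $q\in\mathcal N_2$, a $*$-homomorphism $\Theta:p\mathcal N_1p\to q\mathcal N_2q$ and a nonzero partial isometry $v\in q\mathcal Mp$ such that $\Theta(x)v=vx$ for all $x\in p\mathcal N_1p$. A von Neumann algebra $\mathcal M$ is finite if $v^*v=1$ implies $vv^*=1$ for $v\in\mathcal M$. -/

import Mathlib

namespace VonNeumannAlgebra

section

variable {H : Type*} [NormedAddCommGroup H] [InnerProductSpace ℂ H] [CompleteSpace H]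

/-- `M` is finite: every isometry of `M` is a unitary. -/
def IsFinite (M : VonNeumannAlgebra H) : Prop :=
  ∀ v ∈ M, star v * v = 1 → v * star v = 1

/-- The predual of `M`: the functionals `x ↦ ∑ n, ⟪η n, x (ξ n)⟫` with `∑ ‖ξ n‖ ^ 2 < ∞` and
`∑ ‖η n‖ ^ 2 < ∞`, i.e. the ultraweakly continuous ones, as a subset of the normed dual of `M`. -/
def predual (M : VonNeumannAlgebra H) : Set (StrongDual ℂ M.toStarSubalgebra) :=
  {φ | ∃ ξ η : ℕ → H, Summable (fun n => ‖ξ n‖ ^ 2) ∧ Summable (fun n => ‖η n‖ ^ 2) ∧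
    ∀ x : M.toStarSubalgebra,
      HasSum (fun n => inner ℂ (η n) ((x : H →L[ℂ] H) (ξ n))) (φ x)}

/-- `M` is separable: its predual is separable in norm. -/
def IsSeparable (M : VonNeumannAlgebra H) : Prop :=
  TopologicalSpace.IsSeparable M.predual

/-- `M` is abelian. -/
def IsAbelian (M : VonNeumannAlgebra H) : Prop :=
  ∀ x ∈ M, ∀ y ∈ M, x * y = y * x

/-- The center `M ∩ M'` of `M`. -/
noncomputable def center (M : VonNeumannAlgebra H) : VonNeumannAlgebra H where
  toStarSubalgebra := M.toStarSubalgebra ⊓ M.commutant.toStarSubalgebra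
  centralizer_centralizer' := by
    refine Set.Subset.antisymm (fun x hx => ?_) Set.subset_centralizer_centralizer
    have h₁ : x ∈ Set.centralizer (Set.centralizer (M : Set (H →L[ℂ] H))) :=
      Set.centralizer_subset (Set.centralizer_subset fun y hy => hy.1) hx
    have h₂ : x ∈ Set.centralizer (Set.centralizer (M.commutant : Set (H →L[ℂ] H))) :=
      Set.centralizer_subset (Set.centralizer_subset fun y hy => hy.2) hx
    rw [centralizer_centralizer] at h₁ h₂
    exact ⟨h₁, h₂⟩

theorem mem_center_iff {M : VonNeumannAlgebra H} {x : H →L[ℂ] H} :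
    x ∈ M.center ↔ x ∈ M ∧ ∀ y ∈ M, y * x = x * y := by
  rw [← mem_commutant_iff]
  exact Iff.rfl

/-- The group of unitaries `u ∈ M` with `u A u* = A`. -/
def normalizer (M A : VonNeumannAlgebra H) : Set (H →L[ℂ] H) :=
  {u | u ∈ M ∧ u ∈ unitary (H →L[ℂ] H) ∧
    (fun x => u * x * star u) '' (A : Set (H →L[ℂ] H)) = A}

/-- `A` is regular in `M`: the normalizer of `A` in `M` generates `M` as a von Neumann algebra. -/
def IsRegularIn (A M : VonNeumannAlgebra H) : Prop :=
  Set.centralizer (Set.centralizer (normalizer M A)) = (M : Set (H →L[ℂ] H))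

/-- `M`, regarded as a not necessarily unital `*`-subalgebra of `B(H)`. -/
noncomputable abbrev toNonUnital (M : VonNeumannAlgebra H) : NonUnitalStarSubalgebra ℂ (H →L[ℂ] H) :=
  M.toStarSubalgebra.toNonUnitalStarSubalgebra

/-- For a projection `p ∈ N`, the corner `p N p`, written as `{x ∈ N | p x = x = x p}`. -/
noncomputable def corner (N : NonUnitalStarSubalgebra ℂ (H →L[ℂ] H)) (p : H →L[ℂ] H)
    (hp : IsStarProjection p) : NonUnitalStarSubalgebra ℂ (H →L[ℂ] H) where
  carrier := {x | x ∈ N ∧ p * x = x ∧ x * p = x}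
  zero_mem' := ⟨zero_mem N, by simp, by simp⟩
  add_mem' := fun ⟨h₁, h₂, h₃⟩ ⟨k₁, k₂, k₃⟩ =>
    ⟨add_mem h₁ k₁, by rw [mul_add, h₂, k₂], by rw [add_mul, h₃, k₃]⟩
  mul_mem' := fun ⟨h₁, h₂, _⟩ ⟨k₁, _, k₃⟩ =>
    ⟨mul_mem h₁ k₁, by rw [← mul_assoc, h₂], by rw [mul_assoc, k₃]⟩
  smul_mem' := fun c _ ⟨h₁, h₂, h₃⟩ =>
    ⟨SMulMemClass.smul_mem c h₁, by rw [mul_smul_comm, h₂], by rw [smul_mul_assoc, h₃]⟩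
  star_mem' := fun {x} ⟨h₁, h₂, h₃⟩ => by
    refine ⟨star_mem h₁, ?_, ?_⟩
    · conv_rhs => rw [← h₃, star_mul, hp.isSelfAdjoint.star_eq]
    · conv_rhs => rw [← h₂, star_mul, hp.isSelfAdjoint.star_eq]

theorem mem_corner_iff {N : NonUnitalStarSubalgebra ℂ (H →L[ℂ] H)} {p : H →L[ℂ] H}
    (hp : IsStarProjection p) (hpN : p ∈ N) {x : H →L[ℂ] H} :
    x ∈ corner N p hp ↔ ∃ y ∈ N, x = p * y * p := by
  constructor
  · rintro ⟨h₁, h₂, h₃⟩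
    exact ⟨x, h₁, by rw [h₂, h₃]⟩
  · rintro ⟨y, hy, rfl⟩
    have hpp : p * p = p := hp.isIdempotentElem
    refine ⟨mul_mem (mul_mem hpN hy) hpN, ?_, ?_⟩
    · rw [← mul_assoc, ← mul_assoc, hpp]
    · rw [mul_assoc, hpp]

/-- For a projection `p ∈ N'`, the algebra `N p = {x p | x ∈ N}`, with unit `p`. -/
noncomputable def cutDown (N : VonNeumannAlgebra H) (p : H →L[ℂ] H)
    (hp : IsStarProjection p) (hpN : p ∈ N.commutant) :
    NonUnitalStarSubalgebra ℂ (H →L[ℂ] H) where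
  carrier := {y | ∃ x ∈ N, y = x * p}
  zero_mem' := ⟨0, zero_mem N, by simp⟩
  add_mem' := by
    rintro _ _ ⟨x, hx, rfl⟩ ⟨y, hy, rfl⟩
    exact ⟨x + y, add_mem hx hy, by rw [add_mul]⟩
  mul_mem' := by
    rintro _ _ ⟨x, hx, rfl⟩ ⟨y, hy, rfl⟩
    have hpp : p * p = p := hp.isIdempotentElem
    have hc : y * p = p * y := mem_commutant_iff.1 hpN y hy
    refine ⟨x * y, mul_mem hx hy, ?_⟩
    rw [mul_assoc x p, ← mul_assoc p y, ← hc, mul_assoc y p, hpp, mul_assoc]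
  smul_mem' := by
    rintro c _ ⟨x, hx, rfl⟩
    exact ⟨c • x, N.toStarSubalgebra.smul_mem hx c, by rw [smul_mul_assoc]⟩
  star_mem' := by
    rintro _ ⟨x, hx, rfl⟩
    refine ⟨star x, star_mem hx, ?_⟩
    rw [star_mul, hp.isSelfAdjoint.star_eq]
    exact (mem_commutant_iff.1 hpN (star x) (star_mem hx)).symm

/-- Popa's intertwining `N₁ ≺_M N₂`, for `N₁` not necessarily unital in `M`: there are nonzero
projections `p ∈ N₁`, `q ∈ N₂`, a `*`-homomorphism `Θ : p N₁ p → q N₂ q` and a nonzero partial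
isometry `v ∈ q M p` such that `Θ x v = v x` for all `x ∈ p N₁ p`. -/
def Intertwines (M : VonNeumannAlgebra H) (N₁ : NonUnitalStarSubalgebra ℂ (H →L[ℂ] H))
    (N₂ : VonNeumannAlgebra H) : Prop :=
  ∃ (p q : H →L[ℂ] H) (hp : IsStarProjection p) (hq : IsStarProjection q),
    p ∈ N₁ ∧ p ≠ 0 ∧ q ∈ N₂ ∧ q ≠ 0 ∧
    ∃ (Θ : corner N₁ p hp →⋆ₙₐ[ℂ] corner N₂.toNonUnital q hq) (v : H →L[ℂ] H),
      v ∈ M ∧ q * v = v ∧ v * p = v ∧ v ≠ 0 ∧ v * star v * v = v ∧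
      ∀ x : corner N₁ p hp, (Θ x : H →L[ℂ] H) * v = v * (x : H →L[ℂ] H)

/-- The strong intertwining `N₁ ≺ˢ_M N₂`: one has `N₁ p' ≺_M N₂` for every nonzero projection
`p' ∈ N₁' ∩ M`. -/
def StronglyIntertwines (M N₁ N₂ : VonNeumannAlgebra H) : Prop :=
  ∀ (p' : H →L[ℂ] H) (hp' : IsStarProjection p') (hc : p' ∈ N₁.commutant),
    p' ∈ M → p' ≠ 0 → Intertwines M (cutDown N₁ p' hp' hc) N₂

/-- `A = ⨁ n, S n` as an internal (`ℓ^∞`-)direct sum of von Neumann algebras: every bounded family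
`y n ∈ S n` has a strongly convergent sum lying in `A`, and every element of `A` is such a sum in
a unique way. -/
def IsDirectSum (A : VonNeumannAlgebra H) (S : ℕ → Set (H →L[ℂ] H)) : Prop :=
  (∀ y : ℕ → H →L[ℂ] H, (∀ n, y n ∈ S n) → (∃ C : ℝ, ∀ n, ‖y n‖ ≤ C) →
    ∃ x ∈ A, ∀ ξ : H, HasSum (fun n => y n ξ) (x ξ)) ∧
  (∀ x ∈ A, ∃! y : ℕ → H →L[ℂ] H, (∀ n, y n ∈ S n) ∧ (∃ C : ℝ, ∀ n, ‖y n‖ ≤ C) ∧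
    ∀ ξ : H, HasSum (fun n => y n ξ) (x ξ))

end

end VonNeumannAlgebra

/-! ### Strong sums over pairwise orthogonal projections. -/

section ProjectionFamilies

variable {E : Type*} [NormedAddCommGroup E] [InnerProductSpace ℂ E] [CompleteSpace E]

/-! Since `A` is abelian, each nonzero projection `p ∈ A` lies in `A' ∩ M`, so `A p` intertwines
into the center by some `v`. As `Θ x` is central, `Θ x * v = v * x` says that `v` kills the
difference of `x` and a central element. Hence `A` and the center agree on the `A`-support `r ≤ p`
of `star v`, that is, `A r = Z(M) r` (`Intertwines.exists_isStarProjection_forall_mul_eq`). By Zorn,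
such projections exhaust `1` (`exists_pairwise_mul_eq_zero_of_forall_exists_le`); separability of
the predual makes the family countable, and `isDirectSum_of_forall_mul_eq` assembles the pieces. -/

theorem IsStarProjection.sum_of_pairwise_mul_eq_zero {R ι : Type*} [NonUnitalNonAssocSemiring R]
    [StarRing R] {r : ι → R} (hr : ∀ i, IsStarProjection (r i))
    (horth : ∀ i j, i ≠ j → r i * r j = 0) (s : Finset ι) :
    IsStarProjection (∑ i ∈ s, r i) := by
  classical
  induction s using Finset.induction_on with
  | empty => simp
  | insert a s ha ih =>
    rw [Finset.sum_insert ha]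
    refine (hr a).add ih ?_
    rw [Finset.mul_sum]
    exact Finset.sum_eq_zero fun i hi => horth a i fun h => ha (h ▸ hi)

theorem orthogonalFamily_range_of_isStarProjection {ι : Type*} {r : ι → E →L[ℂ] E}
    (hr : ∀ i, IsStarProjection (r i)) (horth : ∀ i j, i ≠ j → r i * r j = 0) :
    OrthogonalFamily ℂ (fun i => (r i).range) fun i => (r i).range.subtypeₗᵢ := by
  rintro i j hij ⟨_, ξ, rfl⟩ ⟨_, η, rfl⟩
  change inner ℂ (r i ξ) (r j η) = 0
  rw [← ContinuousLinearMap.adjoint_inner_right, ← ContinuousLinearMap.star_eq_adjoint,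
    (hr i).isSelfAdjoint.star_eq, ← mul_apply_eq_comp, horth i j hij]
  simp

/-- Bessel's inequality for a family of pairwise orthogonal projections. -/
theorem sum_norm_sq_apply_le_of_isStarProjection {ι : Type*} {r : ι → E →L[ℂ] E}
    (hr : ∀ i, IsStarProjection (r i)) (horth : ∀ i j, i ≠ j → r i * r j = 0)
    (s : Finset ι) (ξ : E) : ∑ i ∈ s, ‖r i ξ‖ ^ 2 ≤ ‖ξ‖ ^ 2 := by
  have h := (orthogonalFamily_range_of_isStarProjection hr horth).norm_sum
    (fun i => ⟨r i ξ, ξ, rfl⟩) s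
  have h' : ‖∑ i ∈ s, r i ξ‖ ^ 2 = ∑ i ∈ s, ‖r i ξ‖ ^ 2 := h
  rw [← h', ← sum_apply]
  gcongr
  exact (ContinuousLinearMap.le_of_opNorm_le _
    (IsStarProjection.sum_of_pairwise_mul_eq_zero hr horth s).norm_le ξ).trans (one_mul _).le

/-- The vectors `y i ξ` are mutually orthogonal and `‖y i ξ‖ ≤ C * ‖r i ξ‖`, so Bessel's inequality
gives square summability. -/
theorem summable_apply_of_isStarProjection {ι : Type*} {r y : ι → E →L[ℂ] E}
    (hr : ∀ i, IsStarProjection (r i)) (horth : ∀ i j, i ≠ j → r i * r j = 0)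
    (hl : ∀ i, r i * y i = y i) (hrt : ∀ i, y i * r i = y i) {C : ℝ} (hC : ∀ i, ‖y i‖ ≤ C)
    (ξ : E) : Summable fun i => y i ξ := by
  have hmem : ∀ i, y i ξ ∈ (r i).range := fun i =>
    ⟨y i ξ, by
      change (r i * y i) ξ = y i ξ
      rw [hl]⟩
  refine ((orthogonalFamily_range_of_isStarProjection hr horth).summable_iff_norm_sq_summable
    fun i => ⟨y i ξ, hmem i⟩).2 ?_
  refine Summable.of_nonneg_of_le (fun i => by positivity) (fun i => ?_)
    ((summable_of_sum_le (fun i => by positivity) fun s =>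
      sum_norm_sq_apply_le_of_isStarProjection hr horth s ξ).mul_left (C ^ 2))
  change ‖y i ξ‖ ^ 2 ≤ C ^ 2 * ‖r i ξ‖ ^ 2
  rw [← mul_pow]
  gcongr
  calc ‖y i ξ‖ = ‖y i (r i ξ)‖ := by rw [← mul_apply_eq_comp, hrt]
    _ ≤ C * ‖r i ξ‖ := (y i).le_of_opNorm_le (hC i) _

theorem hasSum_apply_of_isStarProjection {ι : Type*} {r : ι → E →L[ℂ] E}
    (hr : ∀ i, IsStarProjection (r i)) (horth : ∀ i j, i ≠ j → r i * r j = 0)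
    (hker : ∀ ξ, (∀ i, r i ξ = 0) → ξ = 0) (ξ : E) : HasSum (fun i => r i ξ) ξ := by
  have hidem : ∀ i, r i * r i = r i := fun i => (hr i).isIdempotentElem
  obtain ⟨η, hη⟩ := summable_apply_of_isStarProjection hr horth hidem hidem
    (fun i => (hr i).norm_le) ξ
  suffices η = ξ by rwa [this] at hη
  refine sub_eq_zero.1 (hker _ fun j => ?_)
  have h₁ : HasSum (fun i => r j (r i ξ)) (r j η) := (r j).hasSum hη
  have h₂ : HasSum (fun i => r j (r i ξ)) (r j (r j ξ)) :=
    hasSum_single j fun i hi => by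
      rw [← mul_apply_eq_comp, horth j i hi.symm, zero_apply]
  rw [map_sub, h₁.unique h₂, ← mul_apply_eq_comp, hidem, sub_self]

end ProjectionFamilies

namespace VonNeumannAlgebra

variable {H : Type*} [NormedAddCommGroup H] [InnerProductSpace ℂ H] [CompleteSpace H]

/-! ### Membership by the bicommutant theorem. -/

/-- The projection onto the joint kernel of a set of elements of `N` lies in `N`. -/
theorem exists_isStarProjection_apply_eq_self_iff (N : VonNeumannAlgebra H)
    {S : Set (H →L[ℂ] H)} (hS : S ⊆ N) :
    ∃ e ∈ N, IsStarProjection e ∧ ∀ ξ, e ξ = ξ ↔ ∀ a ∈ S, a ξ = 0 := by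
  let K : Submodule ℂ H := ⨅ a ∈ S, a.ker
  have hK : ∀ ξ, ξ ∈ K ↔ ∀ a ∈ S, a ξ = 0 := fun ξ => by simp [K, Submodule.mem_iInf]
  have hcl : IsClosed (K : Set H) := by
    have : (K : Set H) = ⋂ a ∈ S, {ξ | a ξ = 0} := by
      ext ξ
      simp [hK]
    rw [this]
    exact isClosed_biInter fun a _ => isClosed_eq a.continuous continuous_const
  have : CompleteSpace K := hcl.completeSpace_coe
  refine ⟨K.starProjection, ?_, isStarProjection_starProjection, fun ξ => ?_⟩
  -- It suffices that the commutant leaves the range `K` invariant.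
  · rw [IsStarProjection.mem_iff isStarProjection_starProjection]
    intro y hy
    rw [Submodule.range_starProjection, Module.End.mem_invtSubmodule]
    intro ξ hξ
    refine (hK _).2 fun a ha => ?_
    have h : a * y = y * a := mem_commutant_iff.1 hy a (hS ha)
    change a (y ξ) = 0
    rw [← mul_apply_eq_comp, h, mul_apply_eq_comp, (hK ξ).1 hξ a ha,
      map_zero]
  · rw [Submodule.starProjection_eq_self_iff, hK]

theorem mem_of_hasSum (N : VonNeumannAlgebra H) {ι : Type*} {y : ι → H →L[ℂ] H}
    (hy : ∀ i, y i ∈ N) {x : H →L[ℂ] H} (hx : ∀ ξ, HasSum (fun i => y i ξ) (x ξ)) : x ∈ N := by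
  rw [← commutant_commutant N, mem_commutant_iff]
  intro g hg
  ext ξ
  refine (g.hasSum (hx ξ)).unique ?_
  have h : ∀ i, g (y i ξ) = y i (g ξ) := fun i => by
    have : y i * g = g * y i := mem_commutant_iff.1 hg _ (hy i)
    rw [← mul_apply_eq_comp, ← this, mul_apply_eq_comp]
  simpa only [h] using! hx (g ξ)

/-! ### Separable predual and countable decomposability. -/

/-- The functional `x ↦ ⟪η, x ξ⟫` on a von Neumann algebra. -/
noncomputable def vectorFunctional (M : VonNeumannAlgebra H) (ξ η : H) :
    StrongDual ℂ M.toStarSubalgebra :=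
  LinearMap.mkContinuous
    { toFun := fun x => inner ℂ η ((x : H →L[ℂ] H) ξ)
      map_add' := fun x y => by simp
      map_smul' := fun c x => by simp }
    (‖η‖ * ‖ξ‖) fun x => by
      change ‖inner ℂ η ((x : H →L[ℂ] H) ξ)‖ ≤ _
      calc ‖inner ℂ η ((x : H →L[ℂ] H) ξ)‖ ≤ ‖η‖ * ‖(x : H →L[ℂ] H) ξ‖ := norm_inner_le_norm _ _
        _ ≤ ‖η‖ * (‖(x : H →L[ℂ] H)‖ * ‖ξ‖) := by
          gcongr
          exact ContinuousLinearMap.le_opNorm _ _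
        _ = ‖η‖ * ‖ξ‖ * ‖x‖ := by
          change _ = ‖η‖ * ‖ξ‖ * ‖(x : H →L[ℂ] H)‖
          ring

theorem vectorFunctional_apply (M : VonNeumannAlgebra H) (ξ η : H) (x : M.toStarSubalgebra) :
    M.vectorFunctional ξ η x = inner ℂ η ((x : H →L[ℂ] H) ξ) :=
  rfl

theorem vectorFunctional_mem_predual (M : VonNeumannAlgebra H) (ξ η : H) :
    M.vectorFunctional ξ η ∈ M.predual := by
  have hs : ∀ ζ : H, Summable fun n : ℕ => ‖(Pi.single 0 ζ : ℕ → H) n‖ ^ 2 := fun ζ =>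
    summable_of_ne_finset_zero (s := {0}) fun n hn => by
      rw [Pi.single_eq_of_ne (by simpa using hn)]
      simp
  refine ⟨Pi.single 0 ξ, Pi.single 0 η, hs ξ, hs η, fun x => ?_⟩
  rw [vectorFunctional_apply]
  have h := hasSum_single (f := fun n => inner ℂ ((Pi.single 0 η : ℕ → H) n)
    ((x : H →L[ℂ] H) ((Pi.single 0 ξ : ℕ → H) n))) 0 fun n hn => by
      simp [Pi.single_eq_of_ne hn]
  simpa only [Pi.single_eq_same] using h

/-- A von Neumann algebra with separable predual is countably decomposable. -/
theorem IsSeparable.countable_of_pairwise_mul_eq_zero {M : VonNeumannAlgebra H}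
    (hsep : M.IsSeparable) {S : Set (H →L[ℂ] H)} (hSM : S ⊆ M)
    (hS : ∀ e ∈ S, IsStarProjection e ∧ e ≠ 0)
    (horth : ∀ e ∈ S, ∀ f ∈ S, e ≠ f → e * f = 0) : S.Countable := by
  have hunit : ∀ e : S, ∃ ξ : H, ‖ξ‖ = 1 ∧ (e : H →L[ℂ] H) ξ = ξ := by
    rintro ⟨e, he⟩
    obtain ⟨ζ, hζ⟩ : ∃ ζ, e ζ ≠ 0 := by
      by_contra! h
      exact (hS e he).2 (ContinuousLinearMap.ext h)
    refine ⟨((‖e ζ‖⁻¹ : ℝ) : ℂ) • e ζ, ?_, ?_⟩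
    · rw [norm_smul, Complex.norm_real, norm_inv, norm_norm, inv_mul_cancel₀ (norm_ne_zero_iff.2 hζ)]
    · have : e * e = e := (hS e he).1.isIdempotentElem
      change e _ = _
      rw [map_smul, ← mul_apply_eq_comp, this]
  choose ξ hξ₁ hξ using hunit
  obtain ⟨c, hc, hdense⟩ := hsep
  -- Vector states of distinct `e`, `f` are at distance at least `1`, as evaluation at `e` shows, so
  -- balls of radius `1 / 2` separate them.
  have hnear : ∀ e : S, ∃ ψ ∈ c, dist (M.vectorFunctional (ξ e) (ξ e)) ψ < 1 / 2 := fun e =>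
    Metric.mem_closure_iff.1 (hdense (M.vectorFunctional_mem_predual (ξ e) (ξ e))) _ (by norm_num)
  choose ψ hψc hψ using hnear
  have : Countable c := hc.to_subtype
  have hinj : Function.Injective fun e : S => (⟨ψ e, hψc e⟩ : c) := by
    intro e f hef
    have hef' : ψ e = ψ f := congrArg Subtype.val hef
    by_contra hne
    have hlt : ‖M.vectorFunctional (ξ e) (ξ e) - M.vectorFunctional (ξ f) (ξ f)‖ < 1 := by
      rw [← dist_eq_norm]
      have h₂ := hψ f
      rw [← hef', dist_comm] at h₂
      linarith [dist_triangle (M.vectorFunctional (ξ e) (ξ e)) (ψ e)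
        (M.vectorFunctional (ξ f) (ξ f)), hψ e]
    have hzero : (e : H →L[ℂ] H) (ξ f) = 0 := by
      rw [← hξ f, ← mul_apply_eq_comp,
        horth e e.2 f f.2 fun h => hne (Subtype.ext h), zero_apply]
    let x : M.toStarSubalgebra := ⟨e, hSM e.2⟩
    have hval : (M.vectorFunctional (ξ e) (ξ e) - M.vectorFunctional (ξ f) (ξ f)) x = 1 := by
      rw [sub_apply, vectorFunctional_apply, vectorFunctional_apply]
      change inner ℂ (ξ e) ((e : H →L[ℂ] H) (ξ e)) - inner ℂ (ξ f) ((e : H →L[ℂ] H) (ξ f)) = 1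
      rw [hzero, hξ, inner_zero_right, sub_zero, inner_self_eq_norm_sq_to_K, hξ₁]
      simp
    have hx : ‖x‖ ≤ 1 := (hS e e.2).1.norm_le
    have h := ContinuousLinearMap.le_opNorm
      (M.vectorFunctional (ξ e) (ξ e) - M.vectorFunctional (ξ f) (ξ f)) x
    rw [hval, norm_one] at h
    have := mul_le_mul_of_nonneg_left hx
      (norm_nonneg (M.vectorFunctional (ξ e) (ξ e) - M.vectorFunctional (ξ f) (ξ f)))
    linarith
  exact Set.countable_coe_iff.1 hinj.countable

/-! ### Cutting down along the intertwiner, and exhaustion. -/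

/-- If `A` is abelian and `A p ≺_M Z(M)`, then below `p` there is a nonzero projection `r` of `A`
with `A r = Z(M) r`. -/
theorem Intertwines.exists_isStarProjection_forall_mul_eq {M A : VonNeumannAlgebra H}
    (hZA : M.center ≤ A) (hab : A.IsAbelian) {p : H →L[ℂ] H} (hp : IsStarProjection p)
    (hpA : p ∈ A) (hc : p ∈ A.commutant) (h : Intertwines M (cutDown A p hp hc) M.center) :
    ∃ r ∈ A, IsStarProjection r ∧ r ≠ 0 ∧ p * r = r ∧
      ∀ x ∈ A, ∃ z ∈ M.center, x * r = z * r := by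
  obtain ⟨e, q, he, hq, ⟨a, ha, rfl⟩, -, -, -, Θ, v, hvM, -, hvp, hv0, -, hΘ⟩ := h
  have hpp : p * p = p := hp.isIdempotentElem
  have heA : a * p ∈ A := mul_mem ha hpA
  have hee : a * p * (a * p) = a * p := he.isIdempotentElem
  have hvpp : v * p = v := by
    conv_lhs => rw [← hvp, mul_assoc, mul_assoc, hpp, hvp]
  have hv : ∀ x ∈ A, ∃ z ∈ M.center, v * (x - z) = 0 := by
    intro x hx
    have hcomm : x * (a * p) = a * p * x := hab _ hx _ heA
    let X : corner (cutDown A p hp hc) (a * p) he :=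
      ⟨x * (a * p), ⟨x * a, mul_mem hx ha, (mul_assoc _ _ _).symm⟩,
        by rw [← mul_assoc, ← hcomm, mul_assoc, hee], by rw [mul_assoc, hee]⟩
    have hz : (Θ X : H →L[ℂ] H) ∈ M.center := (Θ X).2.1
    refine ⟨Θ X, hz, ?_⟩
    have h₁ : (Θ X : H →L[ℂ] H) * v = v * (x * (a * p)) := hΘ X
    have h₂ : v * (Θ X : H →L[ℂ] H) = (Θ X : H →L[ℂ] H) * v := (mem_center_iff.1 hz).2 v hvM
    rw [mul_sub, h₂, h₁, hcomm, ← mul_assoc, hvp, sub_self]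
  -- The projection `r` onto the joint kernel of `S` is the `A`-support of `star v`: an element of
  -- `A` killing `star v` also kills `r`.
  let S : Set (H →L[ℂ] H) := {b | b ∈ A ∧ b * star v = 0}
  obtain ⟨r, hrA, hr, hrS⟩ := A.exists_isStarProjection_apply_eq_self_iff (S := S) fun b hb => hb.1
  have hrr : r * r = r := hr.isIdempotentElem
  have hann : ∀ b ∈ A, b * star v = 0 → b * r = 0 := by
    intro b hb hbv
    ext ξ
    exact (hrS (r ξ)).1 (by rw [← mul_apply_eq_comp, hrr]) b ⟨hb, hbv⟩
  have hrv : r * star v = star v := by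
    ext ξ
    refine (hrS (star v ξ)).2 fun b hb => ?_
    rw [← mul_apply_eq_comp, hb.2, zero_apply]
  refine ⟨r, hrA, hr, ?_, ?_, ?_⟩
  · rintro rfl
    rw [zero_mul] at hrv
    exact hv0 (star_eq_zero.1 hrv.symm)
  · have hpv : p * star v = star v := by
      conv_rhs => rw [← hvpp, star_mul, hp.isSelfAdjoint.star_eq]
    have := hann (1 - p) (sub_mem (one_mem A) hpA) (by rw [sub_mul, one_mul, hpv, sub_self])
    rw [sub_mul, one_mul] at this
    exact (sub_eq_zero.1 this).symm
  · intro x hx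
    obtain ⟨z, hz, hxz⟩ := hv x hx
    refine ⟨z, hz, ?_⟩
    have hmem : x - z ∈ A := sub_mem hx (hZA hz)
    have h₁ : star (x - z) * r = 0 :=
      hann _ (star_mem hmem) (by rw [← star_mul, hxz, star_zero])
    have h₂ : r * (x - z) = 0 := by
      have := congrArg star h₁
      rwa [star_mul, star_star, hr.isSelfAdjoint.star_eq, star_zero] at this
    rw [hab _ hrA _ hmem, sub_mul] at h₂
    exact sub_eq_zero.1 h₂

/-- If below every nonzero projection of `A` there is a nonzero projection of `A` with property
`P`, then `1` is the sum of pairwise orthogonal projections of `A` with property `P`. -/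
theorem exists_pairwise_mul_eq_zero_of_forall_exists_le (A : VonNeumannAlgebra H)
    (P : (H →L[ℂ] H) → Prop)
    (hP : ∀ p ∈ A, IsStarProjection p → p ≠ 0 →
      ∃ r ∈ A, IsStarProjection r ∧ r ≠ 0 ∧ p * r = r ∧ P r) :
    ∃ S : Set (H →L[ℂ] H), (∀ e ∈ S, e ∈ A ∧ IsStarProjection e ∧ e ≠ 0 ∧ P e) ∧
      (∀ e ∈ S, ∀ f ∈ S, e ≠ f → e * f = 0) ∧ ∀ ξ, (∀ e ∈ S, e ξ = 0) → ξ = 0 := by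
  obtain ⟨S, hS⟩ := zorn_subset
    {S : Set (H →L[ℂ] H) | (∀ e ∈ S, e ∈ A ∧ IsStarProjection e ∧ e ≠ 0 ∧ P e) ∧
      ∀ e ∈ S, ∀ f ∈ S, e ≠ f → e * f = 0} fun c hc hchain => by
    refine ⟨⋃₀ c, ⟨?_, ?_⟩, fun s hs => Set.subset_sUnion_of_mem hs⟩
    · rintro e ⟨s, hs, he⟩
      exact (hc hs).1 e he
    · rintro e ⟨s, hs, he⟩ f ⟨t, ht, hf⟩ hef
      rcases hchain.total hs ht with h | h
      · exact (hc ht).2 e (h he) f hf hef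
      · exact (hc hs).2 e he f (h hf) hef
  obtain ⟨hS₁, hS₂⟩ := hS.prop
  refine ⟨S, hS₁, hS₂, fun ξ hξ => ?_⟩
  -- If this `p` were nonzero, the projection `r` found below it could be added to the maximal `S`;
  -- then `r ∈ S` would force `r * r = 0`.
  obtain ⟨p, hpA, hp, hpS⟩ := A.exists_isStarProjection_apply_eq_self_iff fun e he => (hS₁ e he).1
  have hpp : p * p = p := hp.isIdempotentElem
  suffices p = 0 by
    rw [← (hpS ξ).2 hξ, this, zero_apply]
  by_contra hp0
  obtain ⟨r, hrA, hr, hr0, hpr, hPr⟩ := hP p hpA hp hp0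
  have hSr : ∀ e ∈ S, e * r = 0 := by
    intro e he
    ext ξ
    refine (hpS (r ξ)).1 ?_ e he
    rw [← mul_apply_eq_comp, hpr]
  have hrS : ∀ e ∈ S, r * e = 0 := by
    intro e he
    have := congrArg star (hSr e he)
    rwa [star_mul, hr.isSelfAdjoint.star_eq, (hS₁ e he).2.1.isSelfAdjoint.star_eq,
      star_zero] at this
  have hins : r ∈ S := by
    refine hS.le_of_ge (y := insert r S) ⟨?_, ?_⟩ (Set.subset_insert r S) (Set.mem_insert r S)
    · rintro e (rfl | he)
      · exact ⟨hrA, hr, hr0, hPr⟩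
      · exact hS₁ e he
    · rintro e (rfl | he) f (rfl | hf) hef
      · exact absurd rfl hef
      · exact hrS f hf
      · exact hSr e he
      · exact hS₂ e he f hf hef
  have hrr : r * r = r := hr.isIdempotentElem
  exact hr0 (hrr ▸ hSr r hins)

theorem isDirectSum_of_forall_mul_eq {M A : VonNeumannAlgebra H} (hZA : M.center ≤ A)
    (hAM : A ≤ M) {r : ℕ → H →L[ℂ] H} (hrA : ∀ n, r n ∈ A) (hr : ∀ n, IsStarProjection (r n))
    (horth : ∀ m n, m ≠ n → r m * r n = 0) (hsum : ∀ ξ, HasSum (fun n => r n ξ) ξ)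
    (hZ : ∀ n, ∀ x ∈ A, ∃ z ∈ M.center, x * r n = z * r n) :
    A.IsDirectSum fun n => {y | ∃ z ∈ M.center, y = z * r n} := by
  have hidem : ∀ n, r n * r n = r n := fun n => (hr n).isIdempotentElem
  refine ⟨fun y hy ⟨C, hC⟩ => ?_, fun x hx => ?_⟩
  · have hrt : ∀ n, y n * r n = y n := fun n => by
      obtain ⟨z, -, h⟩ := hy n
      rw [h, mul_assoc, hidem]
    have hl : ∀ n, r n * y n = y n := fun n => by
      obtain ⟨z, hz, h⟩ := hy n
      rw [h, ← mul_assoc, (mem_center_iff.1 hz).2 _ (hAM (hrA n)), mul_assoc, hidem]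
    have hsm : ∀ ξ, Summable fun n => y n ξ :=
      summable_apply_of_isStarProjection hr horth hl hrt hC
    -- The pointwise limit is bounded by Banach–Steinhaus.
    let x : H →L[ℂ] H := continuousLinearMapOfTendsto (l := Filter.atTop)
      (fun s : Finset ℕ => ∑ n ∈ s, y n) (f := fun ξ => ∑' n, y n ξ) (tendsto_pi_nhds.2 fun ξ => by
        simpa only [sum_apply] using! (hsm ξ).hasSum)
    have hx : ∀ ξ, HasSum (fun n => y n ξ) (x ξ) := fun ξ => (hsm ξ).hasSum
    refine ⟨x, A.mem_of_hasSum (fun n => ?_) hx, hx⟩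
    obtain ⟨z, hz, h⟩ := hy n
    exact h ▸ mul_mem (hZA hz) (hrA n)
  · refine ⟨fun n => x * r n, ⟨fun n => hZ n x hx, ⟨‖x‖, fun n => ?_⟩, fun ξ => ?_⟩, ?_⟩
    · calc ‖x * r n‖ ≤ ‖x‖ * ‖r n‖ := norm_mul_le _ _
        _ ≤ ‖x‖ * 1 := by
          gcongr
          exact (hr n).norm_le
        _ = ‖x‖ := mul_one _
    · exact x.hasSum (hsum ξ)
    · rintro y ⟨hy, -, hyx⟩
      funext m
      ext ξ
      obtain ⟨z, hz, hzm⟩ := hy m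
      -- On the range of `r m` only the `m`-th term survives, so `y m = x * r m`.
      have hoff : ∀ n, n ≠ m → y n (r m ξ) = 0 := fun n hn => by
        obtain ⟨w, -, hw⟩ := hy n
        rw [← mul_apply_eq_comp, hw, mul_assoc, horth n m hn, mul_zero,
          zero_apply]
      have h : x (r m ξ) = y m (r m ξ) := (hyx (r m ξ)).unique (hasSum_single m hoff)
      rw [mul_apply_eq_comp, h, ← mul_apply_eq_comp, hzm, mul_assoc, hidem]

end VonNeumannAlgebra

theorem mainTheorem9 {H : Type*} [NormedAddCommGroup H] [InnerProductSpace ℂ H] [CompleteSpace H]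
    (M A : VonNeumannAlgebra H)
    (hfin : M.IsFinite) (hsep : M.IsSeparable)
    (hZA : M.center ≤ A) (hAM : A ≤ M)
    (hab : A.IsAbelian) (hreg : A.IsRegularIn M)
    (hint : VonNeumannAlgebra.StronglyIntertwines M A M.center) :
    ∃ r : ℕ → H →L[ℂ] H,
      (∀ n, r n ∈ A ∧ IsStarProjection (r n)) ∧
      (∀ m n, m ≠ n → r m * r n = 0) ∧
      (∀ ξ : H, HasSum (fun n => r n ξ) ξ) ∧
      A.IsDirectSum (fun n => {y | ∃ z ∈ M.center, y = z * r n}) := by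
  obtain ⟨S, hS, hSorth, hSker⟩ := A.exists_pairwise_mul_eq_zero_of_forall_exists_le
    (fun r => ∀ x ∈ A, ∃ z ∈ M.center, x * r = z * r) fun p hpA hp hp0 => by
      have hc : p ∈ A.commutant :=
        VonNeumannAlgebra.mem_commutant_iff.2 fun g hg => hab g hg p hpA
      exact (hint p hp hc (hAM hpA) hp0).exists_isStarProjection_forall_mul_eq hZA hab hp hpA hc
  have hcount : S.Countable := hsep.countable_of_pairwise_mul_eq_zero
    (fun e he => hAM (hS e he).1) (fun e he => ⟨(hS e he).2.1, (hS e he).2.2.1⟩) hSorth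
  have : Countable S := hcount.to_subtype
  obtain ⟨f, hf⟩ := exists_injective_nat S
  -- Indices outside the range of `f` get the zero projection, so a finite `S` needs no separate
  -- case.
  let r : ℕ → H →L[ℂ] H := Function.extend f Subtype.val 0
  have hrf : ∀ e : S, r (f e) = e := fun e => hf.extend_apply _ _ e
  have hr0 : ∀ n, (¬∃ e, f e = n) → r n = 0 := fun n hn => Function.extend_apply' _ _ _ hn
  have hrA : ∀ n, r n ∈ A ∧ IsStarProjection (r n) ∧
      ∀ x ∈ A, ∃ z ∈ M.center, x * r n = z * r n := by
    intro n
    by_cases hn : ∃ e, f e = n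
    · obtain ⟨e, rfl⟩ := hn
      rw [hrf]
      exact ⟨(hS e e.2).1, (hS e e.2).2.1, (hS e e.2).2.2.2⟩
    · rw [hr0 n hn]
      exact ⟨zero_mem A, .zero _, fun x _ => ⟨0, zero_mem _, by rw [mul_zero, mul_zero]⟩⟩
  have horth : ∀ m n, m ≠ n → r m * r n = 0 := by
    intro m n hmn
    by_cases hm : ∃ e, f e = m
    · by_cases hn : ∃ e, f e = n
      · obtain ⟨e, rfl⟩ := hm
        obtain ⟨e', rfl⟩ := hn
        rw [hrf, hrf]
        exact hSorth e e.2 e' e'.2 fun h => hmn (congrArg f (Subtype.ext h))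
      · rw [hr0 n hn, mul_zero]
    · rw [hr0 m hm, zero_mul]
  have hsum : ∀ ξ : H, HasSum (fun n => r n ξ) ξ :=
    hasSum_apply_of_isStarProjection (fun n => (hrA n).2.1) horth fun ξ hξ =>
      hSker ξ fun e he => by
        have h := hξ (f ⟨e, he⟩)
        rwa [hrf] at h
  exact ⟨r, fun n => ⟨(hrA n).1, (hrA n).2.1⟩, horth, hsum,
    VonNeumannAlgebra.isDirectSum_of_forall_mul_eq hZA hAM (fun n => (hrA n).1)
      (fun n => (hrA n).2.1) horth hsum fun n => (hrA n).2.2⟩
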